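/- Let $\varepsilon>0$ and let $K$ be the Bessel kernel on $[-1,1]\times[-1,1]$, $$K(x,y)=\mathcal I_0\big(2\sqrt{\varepsilon xy}\,\big)=\sum_{k=0}^\infty \alpha_k^{-1}x^ky^k,\qquad \alpha_k=\varepsilon^{-k}(k!)^2,$$ where $\mathcal I_0(z)=\sum_{k\ge 0}(z^2/4)^k/(k!)^2$ is the modified Bessel function of the first kind of order zero (an even entire function, so that the choice of the square root, also for $xy<0$, is immaterial). Let $H(K)$ be the reproducing kernel Hilbert space of $K$, with norm $\|\cdot\|_K$. For pairwise distinct points $x_1,\dots,x_n\in[-1,1]$ and Lebesgue measurable functions $\psi_1,\dots,\psi_n\colon[-1,1]\to\mathbb R$ consider the linear approximation $$A_nf=\sum_{k=1}^n f(x_k)\psi_k \qquad (\ast)$$ and put $$e_\infty(A_n)=\sup_{0\ne f\in H(K)}\frac{\sup_{x\in[-1,1]}|f(x)-(A_nf)(x)|}{\|f\|_K}\in[0,\infty],\qquad e_\infty^{\min}(n)=\inf_{A_n}e_\infty(A_n),$$ the infimum being over all $A_n$ of the form $(\ast)$. For $\lambda>0$ let $$c_L(\lambda)=\frac{e^{-\frac32\lambda+2\sqrt\lambda}}{2\sqrt\pi\,\lambda^{1/4}}\Big(3+\sqrt{\tfrac{\pi}{e}}+\frac{2}{\sqrt\pi\,\lambda^{1/4}}+\frac{7}{16\sqrt\lambda}+\sqrt\lambda(2+\lambda)\Big),$$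 $$m_L(\lambda)=\max\Big\{5\lambda,\ \lambda\big(1+\tfrac\lambda2\big)^2,\ \tfrac9\lambda\Big\},$$ and let $$c_1=\sqrt{\frac{2}{1+\varepsilon}}\;e^{-\frac1{32}\varepsilon^2},\qquad c_2=2\sqrt{c_L(\varepsilon)}.$$ Then for every integer $n\ge m_L(\varepsilon)$ $$c_1\Big(\frac{\varepsilon^{1/2}}2\Big)^n(n!)^{-1}\le e_\infty^{\min}(n)\le c_2\,n^{-1/8}e^{\sqrt{\varepsilon n}}\Big(\frac{\varepsilon^{1/2}}2\Big)^n(n!)^{-1},$$ and for any pairwise distinct $x_1,\dots,x_n\in[-1,1]$ there is a linear approximation $A_n$ of the form $(\ast)$ that uses these points such that $$c_1\Big(\frac{\varepsilon^{1/2}}2\Big)^n(n!)^{-1}\le e_\infty(A_n)\le \frac{c_2}2\,n^{-1/8}e^{\sqrt{\varepsilon n}}\,(2\varepsilon^{1/2})^n(n!)^{-1}.$$ -/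

import Mathlib

open scoped ENNReal

/-- The interval `[-1, 1]`, on which all functions live. -/
abbrev UnitSym : Type := ↥(Set.Icc (-1 : ℝ) 1)

/-- The modified Bessel function of the first kind of order zero,
`I₀(z) = ∑ (z² / 4)ᵏ / (k!)²`. -/
noncomputable def besselI0 (z : ℂ) : ℂ :=
  ∑' k : ℕ, (z ^ 2 / 4) ^ k / ((k.factorial : ℂ) ^ 2)

/-- The Bessel kernel `K(x, y) = I₀(2 √(ε x y))` on `[-1, 1]`. The square root is the complex one,
as `x y` may be negative; `I₀` is even, so that the choice of the branch is immaterial, and the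
value is real (see `besselKernel_eq_tsum`). -/
noncomputable def besselKernel (ε : ℝ) (x y : UnitSym) : ℝ :=
  (besselI0 (2 * (((ε * x * y : ℝ) : ℂ) ^ (1 / 2 : ℂ)))).re

/-- `H` is the reproducing kernel Hilbert space `H(K)` of the scalar kernel `K` : its reproducing
kernel (an operator on the one-dimensional space `ℝ` for each pair of points) is
multiplication by `K x y`. -/
def HasScalarKernel (H : Type*) {X : Type*} [NormedAddCommGroup H] [InnerProductSpace ℝ H]
    [CompleteSpace H] [RKHS ℝ H X ℝ] (K : X → X → ℝ) : Prop :=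
  ∀ x y : X, RKHS.kernel H x y = K x y • ContinuousLinearMap.id ℝ ℝ

/-- The data of a linear approximation `A f = ∑ₖ f(xₖ) ψₖ` that uses `n` function evaluations:
pairwise distinct points `xₖ ∈ [-1, 1]` and Lebesgue measurable functions `ψₖ : [-1, 1] → ℝ`. -/
structure LinearApprox (n : ℕ) where
  point : Fin n → UnitSym
  point_injective : Function.Injective point
  weight : Fin n → UnitSym → ℝ
  weight_measurable : ∀ k,
    MeasureTheory.NullMeasurable (weight k) (MeasureTheory.volume.comap (Subtype.val : UnitSym → ℝ))

/-- The function `A f = ∑ₖ f(xₖ) ψₖ`. -/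
noncomputable def LinearApprox.apply {n : ℕ} (A : LinearApprox n) (f : UnitSym → ℝ) :
    UnitSym → ℝ :=
  fun x => ∑ k, f (A.point k) * A.weight k x

/-- The uniform norm `sup_{x ∈ [-1, 1]} |g x|`, possibly infinite. -/
noncomputable def uniformNorm (g : UnitSym → ℝ) : ℝ≥0∞ :=
  ⨆ x, ENNReal.ofReal |g x|

section Errors

variable (H : Type*) [NormedAddCommGroup H] [InnerProductSpace ℝ H] [RKHS ℝ H UnitSym ℝ]

/-- The worst-case error `e_∞(A) = sup_{0 ≠ f ∈ H} ‖f - A f‖_∞ / ‖f‖_H`, possibly infinite. -/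
noncomputable def worstCaseError {n : ℕ} (A : LinearApprox n) : ℝ≥0∞ :=
  ⨆ (f : H) (_ : f ≠ 0), uniformNorm (fun x => f x - A.apply f x) / ENNReal.ofReal ‖f‖

/-- The `n`th minimal error `e_∞^min(n) = inf_A e_∞(A)`. -/
noncomputable def minimalError (n : ℕ) : ℝ≥0∞ :=
  ⨅ A : LinearApprox n, worstCaseError H A

end Errors

/-- The function `c_L`. -/
noncomputable def cL (l : ℝ) : ℝ :=
  Real.exp (-(3 / 2) * l + 2 * √l) / (2 * √Real.pi * l ^ (1 / 4 : ℝ)) *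
    (3 + √(Real.pi / Real.exp 1) + 2 / (√Real.pi * l ^ (1 / 4 : ℝ)) + 7 / (16 * √l)
      + √l * (2 + l))

/-- The function `m_L`. -/
noncomputable def mL (l : ℝ) : ℝ :=
  max (max (5 * l) (l * (1 + l / 2) ^ 2)) (9 / l)

/-- The Bessel kernel is the power series kernel `∑ αₖ⁻¹ xᵏ yᵏ` with `αₖ = ε⁻ᵏ (k!)²`. -/
theorem besselKernel_eq_tsum (ε : ℝ) (x y : UnitSym) :
    besselKernel ε x y =
      ∑' k : ℕ, (ε⁻¹ ^ k * (k.factorial : ℝ) ^ 2)⁻¹ * (x : ℝ) ^ k * (y : ℝ) ^ k := by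
  have h : besselI0 (2 * (((ε * x * y : ℝ) : ℂ) ^ (1 / 2 : ℂ))) =
      ((∑' k : ℕ, (ε⁻¹ ^ k * (k.factorial : ℝ) ^ 2)⁻¹ * (x : ℝ) ^ k * (y : ℝ) ^ k : ℝ) : ℂ) := by
    rw [besselI0, Complex.ofReal_tsum]
    refine tsum_congr fun k => ?_
    have h2 : ((((ε * x * y : ℝ) : ℂ) ^ (1 / 2 : ℂ))) ^ 2 = ((ε * x * y : ℝ) : ℂ) := by
      simp
    rw [mul_pow, h2]
    push_cast
    rw [mul_inv, inv_pow, inv_inv]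
    ring
  rw [besselKernel, h, Complex.ofReal_re]

theorem summable_bessel (ε : ℝ) (x y : UnitSym) :
    Summable fun k : ℕ => (ε⁻¹ ^ k * (k.factorial : ℝ) ^ 2)⁻¹ * (x : ℝ) ^ k * (y : ℝ) ^ k := by
  refine Summable.of_norm_bounded (g := fun k : ℕ => |ε * x * y| ^ k / (k.factorial : ℝ))
    (Real.summable_pow_div_factorial _) fun k => ?_
  have h1 : (1 : ℝ) ≤ k.factorial := by exact_mod_cast Nat.one_le_iff_ne_zero.2 k.factorial_ne_zero
  have : (ε⁻¹ ^ k * (k.factorial : ℝ) ^ 2)⁻¹ * (x : ℝ) ^ k * (y : ℝ) ^ k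
      = (ε * x * y) ^ k / (k.factorial : ℝ) ^ 2 := by
    rw [mul_inv, inv_pow, inv_inv]; ring
  rw [this, norm_div, norm_pow, norm_pow, Real.norm_eq_abs, Real.norm_natCast]
  gcongr
  nlinarith

/-- The Bessel kernel is positive semidefinite. -/
theorem posSemidef_besselKernel {ε : ℝ} (hε : 0 < ε) :
    (Matrix.of fun x y => besselKernel ε x y • ContinuousLinearMap.id ℝ ℝ :
      Matrix UnitSym UnitSym (ℝ →L[ℝ] ℝ)).PosSemidef := by
  have key := RKHS.posSemidef_tfae (𝕜 := ℝ) (K := (Matrix.of fun x y =>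
    besselKernel ε x y • ContinuousLinearMap.id ℝ ℝ : Matrix UnitSym UnitSym (ℝ →L[ℝ] ℝ)))
  apply (key.out 0 2).mpr
  refine ⟨?_, fun v => ?_⟩
  · ext x y
    have hst : star (ContinuousLinearMap.id ℝ ℝ) = ContinuousLinearMap.id ℝ ℝ :=
      star_one (ℝ →L[ℝ] ℝ)
    simp [hst, besselKernel_eq_tsum, Matrix.conjTranspose_apply, mul_right_comm]
  · have : (v.sum fun x w => v.sum fun x' w' =>
        inner ℝ ((Matrix.of fun x y => besselKernel ε x y • ContinuousLinearMap.id ℝ ℝ :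
          Matrix UnitSym UnitSym (ℝ →L[ℝ] ℝ)) x' x w) w') =
        ∑' k : ℕ, (ε⁻¹ ^ k * (k.factorial : ℝ) ^ 2)⁻¹ * (∑ x ∈ v.support, v x * (x : ℝ) ^ k) ^ 2 := by
      have hs : ∀ k : ℕ, (ε⁻¹ ^ k * (k.factorial : ℝ) ^ 2)⁻¹ *
          (∑ x ∈ v.support, v x * (x : ℝ) ^ k) ^ 2 = ∑ x ∈ v.support, ∑ x' ∈ v.support,
            ((ε⁻¹ ^ k * (k.factorial : ℝ) ^ 2)⁻¹ * (x' : ℝ) ^ k * (x : ℝ) ^ k) * (v x * v x') := by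
        intro k
        rw [sq (∑ x ∈ v.support, v x * (x : ℝ) ^ k), Finset.sum_mul_sum, Finset.mul_sum]
        refine Finset.sum_congr rfl fun x _ => ?_
        rw [Finset.mul_sum]
        exact Finset.sum_congr rfl fun x' _ => by ring
      simp_rw [hs]
      rw [Summable.tsum_finsetSum fun x _ => summable_sum fun x' _ =>
        (summable_bessel ε x' x).mul_right _]
      refine Finset.sum_congr rfl fun x _ => ?_
      rw [Summable.tsum_finsetSum fun x' _ => (summable_bessel ε x' x).mul_right _]
      refine Finset.sum_congr rfl fun x' _ => ?_
      rw [tsum_mul_right, ← besselKernel_eq_tsum]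
      simp
      ring
    rw [this]
    exact tsum_nonneg fun k => by positivity

/-- For each `ε > 0` the reproducing kernel Hilbert space of the Bessel kernel exists. -/
theorem exists_besselRKHS {ε : ℝ} (hε : 0 < ε) :
    ∃ (H : Type) (_ : NormedAddCommGroup H) (_ : InnerProductSpace ℝ H) (_ : CompleteSpace H)
      (_ : RKHS ℝ H UnitSym ℝ), HasScalarKernel H (besselKernel ε) := by
  have : Fact (Matrix.of fun x y => besselKernel ε x y • ContinuousLinearMap.id ℝ ℝ :
      Matrix UnitSym UnitSym (ℝ →L[ℝ] ℝ)).PosSemidef := ⟨posSemidef_besselKernel hε⟩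
  exact ⟨RKHS.OfKernel (Matrix.of fun x y => besselKernel ε x y • ContinuousLinearMap.id ℝ ℝ :
      Matrix UnitSym UnitSym (ℝ →L[ℝ] ℝ)), inferInstance, inferInstance, inferInstance,
      inferInstance, fun x y => by rw [RKHS.OfKernel.kernel_ofKernel]; rfl⟩

/-! Fix `x` and nodes `v i`, and let `ω(x) = ∏ i, (x - v i)`. By the reproducing property, `f x - A
f x` is the inner product of `f` with an error representer, so the worst-case error is the supremum
over `x` of the norms of these representers. The squared norm is `∑ ε^k/(k!)² g_k²`, where `g_k` is
the error at `x` for the monomial of degree `k`.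

For Lagrange interpolation `g_k = q_k(x) ω(x)` with `|q_k(x)| ≤ choose k n`. The binomials cancel
against the factorials, and the error is at most `sup |ω| · √ε^n/n! · √B`, where `B = ∑ ε^k/(k!)²`.

For any weights, the combination of the `g_k` with the coefficients of `ω` equals `ω(x)`, because
`ω` vanishes at the nodes. The coefficient of degree `k` is at most `choose n k`, so Cauchy–Schwarz
gives the lower bound `sup |ω| · √ε^n/n! / √B` with the same `B`.

Chebyshev's theorem supplies `sup |ω| ≥ 2^(1-n)`, with equality at Chebyshev nodes; arbitrary nodes
give `sup |ω| ≤ 2^n`. Two estimates of `B` then produce `c₁` and `c₂`. -/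

/-! ### Nodal polynomials and interpolation of monomials -/

open Polynomial in
/-- Division of `Xᵏ` by the nodal polynomial of points in `[-1, 1]`: the quotient is bounded by a
binomial coefficient on `[-1, 1]`. -/
theorem exists_quotient_nodal_abs_le_choose {ι : Type*} [DecidableEq ι] (s : Finset ι) (v : ι → ℝ)
    (hv : ∀ i ∈ s, |v i| ≤ 1) :
    ∃ q : ℕ → ℝ[X], ∀ k, (X ^ k - q k * Lagrange.nodal s v).degree < (s.card : WithBot ℕ) ∧
      ∀ x : ℝ, |x| ≤ 1 → |(q k).eval x| ≤ k.choose s.card := by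
  induction s using Finset.induction_on with
  | empty =>
    refine ⟨fun k => X ^ k, fun k => ⟨by simp, fun x hx => ?_⟩⟩
    simpa using pow_le_one₀ (abs_nonneg x) hx
  | insert a s ha ih =>
    obtain ⟨q, hq⟩ := ih fun i hi => hv i (Finset.mem_insert_of_mem hi)
    -- The quotient is the complete homogeneous symmetric polynomial of degree `k - card` in `x` and
    -- the nodes. This is its recursion in the node `a`, matching Pascal's rule.
    refine ⟨fun k => Nat.rec 0 (fun k r => C (v a) * r + q k) k, fun k => ?_⟩
    rw [Finset.card_insert_of_notMem ha, Lagrange.nodal_insert_eq_nodal ha]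
    induction k with
    | zero =>
      refine ⟨?_, fun x _ => by simp⟩
      change (X ^ 0 - 0 * _ : ℝ[X]).degree < _
      rw [pow_zero, zero_mul, sub_zero, degree_one]
      exact_mod_cast Nat.succ_pos _
    | succ k ihk =>
      simp only at ihk ⊢
      set r : ℝ[X] := Nat.rec 0 (fun k r => C (v a) * r + q k) k with hr
      set N := Lagrange.nodal s v with hN
      constructor
      · have e : X ^ (k + 1) - (C (v a) * r + q k) * ((X - C (v a)) * N) =
            X * (X ^ k - q k * N) + C (v a) * ((X ^ k - r * ((X - C (v a)) * N)) -
              (X ^ k - q k * N)) := by ring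
        rw [e]
        have h1 : (X * (X ^ k - q k * N)).degree < ((s.card + 1 : ℕ) : WithBot ℕ) := by
          rw [mul_comm, degree_mul_X]
          push_cast
          exact WithBot.add_lt_add_right (by simp) (hq k).1
        have h0 : (X ^ k - q k * N).degree < ((s.card + 1 : ℕ) : WithBot ℕ) :=
          (hq k).1.trans (by exact_mod_cast Nat.lt_succ_self _)
        refine (degree_add_le _ _).trans_lt (max_lt h1 ?_)
        rw [← smul_eq_C_mul]
        refine lt_of_le_of_lt (degree_smul_le _ _) ?_
        exact (degree_sub_le _ _).trans_lt (max_lt ihk.1 h0)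
      · intro x hx
        rw [eval_add, eval_mul, eval_C, Nat.choose_succ_succ]
        push_cast
        have h1 := ihk.2 x hx
        have h2 := (hq k).2 x hx
        have h3 := hv a (Finset.mem_insert_self a s)
        calc |v a * r.eval x + (q k).eval x| ≤ |v a| * |r.eval x| + |(q k).eval x| := by
              rw [← abs_mul]; exact abs_add_le _ _
          _ ≤ 1 * (k.choose (s.card + 1)) + k.choose s.card := by gcongr
          _ = _ := by ring

open Polynomial in
/-- The error of Lagrange interpolation of `xᵏ` at points of `[-1, 1]`. -/
theorem abs_pow_sub_sum_basis_le {n : ℕ} (v : Fin n → ℝ) (hinj : Function.Injective v)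
    (hv : ∀ i, |v i| ≤ 1) (k : ℕ) {x : ℝ} (hx : |x| ≤ 1) :
    |x ^ k - ∑ i, (Lagrange.basis Finset.univ v i).eval x * v i ^ k| ≤
      k.choose n * |∏ i, (x - v i)| := by
  obtain ⟨q, hq⟩ := exists_quotient_nodal_abs_le_choose Finset.univ v fun i _ => hv i
  have h := Lagrange.eq_interpolate (s := Finset.univ) hinj.injOn (hq k).1
  have h2 := congrArg (eval x) h
  simp only [Lagrange.interpolate_apply, eval_finsetSum, eval_mul, eval_C, eval_sub, eval_pow,
    eval_X, Lagrange.eval_nodal] at h2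
  have h3 : ∀ i, ∏ j, (v i - v j) = 0 := fun i =>
    Finset.prod_eq_zero (Finset.mem_univ i) (sub_self _)
  simp only [h3, mul_zero, sub_zero] at h2
  have h4 : x ^ k - ∑ i, (Lagrange.basis Finset.univ v i).eval x * v i ^ k =
      (q k).eval x * ∏ i, (x - v i) := by
    rw [Finset.sum_congr rfl fun i _ => mul_comm _ _, ← h2]
    ring
  rw [h4, abs_mul]
  have := (hq k).2 x hx
  rw [Finset.card_univ, Fintype.card_fin] at this
  gcongr

open Polynomial in
-- Up to sign the coefficients are elementary symmetric polynomials of the nodes; the induction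
-- follows Pascal's rule.
theorem abs_coeff_nodal_le_choose {ι : Type*} [DecidableEq ι] (s : Finset ι) (v : ι → ℝ)
    (hv : ∀ i ∈ s, |v i| ≤ 1) (k : ℕ) : |(Lagrange.nodal s v).coeff k| ≤ s.card.choose k := by
  induction s using Finset.induction_on generalizing k with
  | empty => cases k <;> simp [coeff_one]
  | insert a s ha ih =>
    have ih := fun k => ih (fun i hi => hv i (Finset.mem_insert_of_mem hi)) k
    have h3 := hv a (Finset.mem_insert_self a s)
    rw [Finset.card_insert_of_notMem ha, Lagrange.nodal_insert_eq_nodal ha, sub_mul]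
    cases k with
    | zero =>
      have := ih 0
      simp only [coeff_sub, mul_coeff_zero, coeff_X_zero, coeff_C_zero, zero_mul, zero_sub,
        abs_neg, abs_mul, Nat.choose_zero_right, Nat.cast_one] at this ⊢
      exact mul_le_one₀ h3 (abs_nonneg _) this
    | succ k =>
      rw [coeff_sub, coeff_X_mul, coeff_C_mul, Nat.choose_succ_succ]
      push_cast
      calc _ ≤ |(Lagrange.nodal s v).coeff k| + |v a| * |(Lagrange.nodal s v).coeff (k + 1)| := by
            rw [← abs_mul]; exact abs_sub _ _
        _ ≤ s.card.choose k + 1 * s.card.choose (k + 1) := by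
            gcongr
            · exact ih k
            · exact ih (k + 1)
        _ = _ := by ring

/-! ### Chebyshev's extremal problem -/

open Polynomial in
/-- A monic polynomial of degree `n` takes a value of modulus at least `2¹⁻ⁿ` on `[-1, 1]`. -/
theorem exists_two_mul_half_pow_le_abs_prod {n : ℕ} (hn : n ≠ 0) (v : Fin n → ℝ) :
    ∃ x ∈ Set.Icc (-1 : ℝ) 1, 2 * (1 / 2) ^ n ≤ |∏ i, (x - v i)| := by
  set P := Lagrange.nodal Finset.univ v with hP
  have hev : ∀ x, P.eval x = ∏ i, (x - v i) := fun x => Lagrange.eval_nodal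
  obtain ⟨x, hx, hmax⟩ := (isCompact_Icc (a := (-1 : ℝ)) (b := 1)).exists_isMaxOn
    ⟨0, by simp⟩ (f := fun x => |P.eval x|) (by fun_prop)
  refine ⟨x, hx, ?_⟩
  rw [← hev]
  have hdeg : P.natDegree = n := by rw [hP, Lagrange.natDegree_nodal]; simp
  have hmonic : P.Monic := Lagrange.nodal_monic
  have hM : 0 < |P.eval x| := by
    by_contra! h0
    have hz : P = 0 := by
      refine Polynomial.eq_zero_of_infinite_isRoot P ((Set.Icc_infinite (by norm_num :
        (-1 : ℝ) < 1)).mono fun y hy => ?_)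
      exact abs_nonpos_iff.1 ((hmax hy).trans h0)
    exact hmonic.ne_zero hz
  -- Dividing by the maximum gives a polynomial bounded by 1 on the interval, whose leading
  -- coefficient is at most `2^(n-1)`.
  have key := Polynomial.Chebyshev.coeff_le_of_forall_abs_le_one (n := n)
    (P := C |P.eval x|⁻¹ * P) ?_ ?_
  · rw [coeff_C_mul, ← hdeg, hmonic.coeff_natDegree, mul_one, hdeg,
      inv_le_comm₀ hM (by positivity)] at key
    refine le_trans (le_of_eq ?_) key
    obtain ⟨m, rfl⟩ := Nat.exists_eq_succ_of_ne_zero hn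
    rw [Nat.succ_sub_one, pow_succ, one_div, inv_pow]
    ring
  · rw [← smul_eq_C_mul, ← hdeg]
    exact (degree_smul_le _ _).trans degree_le_natDegree
  · intro y hy
    rw [eval_mul, eval_C, abs_mul, abs_inv, abs_abs, inv_mul_le_iff₀ hM, mul_one]
    exact hmax hy

open Polynomial in
/-- The zeros of the Chebyshev polynomial `Tₙ` attain the minimal maximum `2¹⁻ⁿ`. -/
theorem exists_chebyshev_nodes {n : ℕ} (hn : n ≠ 0) :
    ∃ v : Fin n → UnitSym, Function.Injective v ∧
      ∀ x : UnitSym, |∏ i, ((x : ℝ) - v i)| ≤ 2 * (1 / 2) ^ n := by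
  let c : ℕ → ℝ := fun k => Real.cos ((2 * k + 1) * Real.pi / (2 * n))
  have hinj : Set.InjOn c (Finset.range n) :=
    (Finset.range n).nodup_map_iff_injOn.mp (Chebyshev.roots_T_real_nodup n)
  refine ⟨fun i => ⟨c i, Real.cos_mem_Icc _⟩, fun i j hij => ?_, fun x => ?_⟩
  · exact Fin.ext (hinj (by simp) (by simp) (congrArg Subtype.val hij))
  · have hroots : (Chebyshev.T ℝ n).roots = (Finset.range n).val.map c := by
      rw [Chebyshev.roots_T_real, Finset.image_val_of_injOn hinj]
    have h := C_leadingCoeff_mul_prod_multiset_X_sub_C (p := Chebyshev.T ℝ n)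
      (by rw [hroots]; simp)
    have h2 := congrArg (eval (x : ℝ)) h
    rw [hroots, Multiset.map_map, eval_mul, eval_C, Chebyshev.leadingCoeff_T] at h2
    have h3 : eval (x : ℝ) (((Finset.range n).val.map ((fun a => X - C a) ∘ c)).prod) =
        ∏ i : Fin n, ((x : ℝ) - c i) := by
      rw [← Finset.prod_range (fun i => (x : ℝ) - c i)]
      change eval (x : ℝ) (∏ i ∈ Finset.range n, (X - C (c i))) = _
      simp [eval_prod]
    rw [h3] at h2
    have h4 := Chebyshev.abs_eval_T_real_le_one n (abs_le.2 x.2)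
    rw [← h2, abs_mul, abs_of_pos (by positivity), Int.natAbs_natCast,
      ← le_div_iff₀' (by positivity)] at h4
    refine h4.trans (le_of_eq ?_)
    obtain ⟨m, rfl⟩ := Nat.exists_eq_succ_of_ne_zero hn
    rw [Nat.succ_sub_one, pow_succ, one_div, one_div, inv_pow]
    ring

/-! ### Estimates of `B = ∑ ε^k/(k!)²` -/

theorem summable_pow_div_factorial_sq (ε : ℝ) :
    Summable fun k : ℕ => ε ^ k / (k.factorial : ℝ) ^ 2 := by
  refine (summable_bessel ε ⟨1, by simp⟩ ⟨1, by simp⟩).congr fun k => ?_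
  rw [mul_inv, inv_pow, inv_inv]
  simp [div_eq_mul_inv]

theorem hasSum_pow_div_factorial_exp (x : ℝ) :
    HasSum (fun k : ℕ => x ^ k / (k.factorial : ℝ)) (Real.exp x) := by
  rw [Real.exp_eq_exp_ℝ]
  exact NormedSpace.expSeries_div_hasSum_exp x

/-- With `a_k = √ε^k/k!`, this is `∑ a_k² ≤ (∑ a_k)²`. -/
theorem tsum_pow_div_factorial_sq_le_exp {ε : ℝ} (hε : 0 ≤ ε) :
    ∑' k : ℕ, ε ^ k / (k.factorial : ℝ) ^ 2 ≤ Real.exp (2 * √ε) := by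
  have h := hasSum_pow_div_factorial_exp √ε
  have h2 : Real.exp (2 * √ε) = Real.exp √ε * Real.exp √ε := by rw [← Real.exp_add]; ring_nf
  rw [h2]
  refine hasSum_le (fun k => ?_) (summable_pow_div_factorial_sq ε).hasSum (h.mul_left _)
  have h3 : √ε ^ k / (k.factorial : ℝ) ≤ Real.exp √ε :=
    le_hasSum h k fun j _ => by positivity
  have h4 : ε ^ k / (k.factorial : ℝ) ^ 2 =
      √ε ^ k / (k.factorial : ℝ) * (√ε ^ k / (k.factorial : ℝ)) := by
    rw [div_mul_div_comm, ← mul_pow, Real.mul_self_sqrt hε, sq]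
  rw [h4]
  gcongr

/-- The shift by 2 is needed: `16^m m! ≤ ((2m)!)²` fails at `m = 1`. -/
theorem sixteen_pow_mul_factorial_le_sq (j : ℕ) :
    16 ^ (j + 2) * (j + 2).factorial ≤ (2 * (j + 2)).factorial ^ 2 := by
  induction j with
  | zero => decide
  | succ j ih =>
    have e : (2 * (j + 1 + 2)).factorial =
        (2 * j + 6) * ((2 * j + 5) * (2 * (j + 2)).factorial) := by
      rw [show 2 * (j + 1 + 2) = 2 * (j + 2) + 1 + 1 by ring, Nat.factorial_succ,
        Nat.factorial_succ]
      ring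
    have e2 : (j + 1 + 2).factorial = (j + 3) * (j + 2).factorial := Nat.factorial_succ _
    rw [e, e2]
    calc 16 ^ (j + 1 + 2) * ((j + 3) * (j + 2).factorial)
        = (16 * (j + 3)) * (16 ^ (j + 2) * (j + 2).factorial) := by ring
      _ ≤ ((2 * j + 6) * (2 * j + 5)) ^ 2 * (2 * (j + 2)).factorial ^ 2 := by
          gcongr
          nlinarith [Nat.zero_le (j ^ 2), Nat.zero_le (j ^ 3), Nat.zero_le (j ^ 4)]
      _ = _ := by ring

/-- Even and odd terms are each compared with the series of `exp (ε²/16)`. -/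
theorem tsum_pow_div_factorial_sq_le_mul_exp {ε : ℝ} (hε : 0 ≤ ε) :
    ∑' k : ℕ, ε ^ k / (k.factorial : ℝ) ^ 2 ≤ 2 * (1 + ε) * Real.exp (ε ^ 2 / 16) := by
  have hexp := hasSum_pow_div_factorial_exp (ε ^ 2 / 16)
  set d : ℕ → ℝ := fun j => (ε ^ 2 / 16) ^ j / (j.factorial : ℝ) with hd
  set D := Real.exp (ε ^ 2 / 16) with hD
  set b : ℕ → ℝ := fun k => ε ^ k / (k.factorial : ℝ) ^ 2 with hb
  have hs : Summable b := summable_pow_div_factorial_sq ε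
  have hcast : ∀ j, (16 : ℝ) ^ (j + 2) * (j + 2).factorial ≤ ((2 * (j + 2)).factorial : ℝ) ^ 2 :=
    fun j => by exact_mod_cast sixteen_pow_mul_factorial_le_sq j
  have hd' : ∀ j, d j = ε ^ (2 * j) / (16 ^ j * j.factorial) := fun j => by
    simp only [hd, pow_mul, div_pow, div_div]
  -- At `j = 1` the term `ε²/4` exceeds `ε²/16`; the excess `3ε²/16` is absorbed by the factor 2 at
  -- the end.
  have heven : ∀ j, b (2 * j) ≤ d j + if j = 1 then 3 * ε ^ 2 / 16 else 0 := by
    intro j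
    rw [hd']
    match j with
    | 0 => simp [hb]
    | 1 =>
      simp only [hb]
      norm_num [Nat.factorial]
      linarith
    | j + 2 =>
      simp only [hb]
      rw [if_neg (by omega), add_zero]
      gcongr
      exact hcast j
  have hodd : ∀ j, b (2 * j + 1) ≤ ε * d j := by
    intro j
    have e : b (2 * j + 1) = ε * (ε ^ (2 * j) / ((2 * j + 1).factorial : ℝ) ^ 2) := by
      simp only [hb]; ring
    rw [e, hd']
    gcongr
    match j with
    | 0 => simp
    | 1 => norm_num [Nat.factorial]
    | j + 2 =>
      refine (hcast j).trans ?_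
      gcongr
      omega
  have hev : Summable fun j => b (2 * j) := hs.comp_injective (mul_right_injective₀ two_ne_zero)
  have hod : Summable fun j => b (2 * j + 1) :=
    hs.comp_injective ((add_left_injective 1).comp (mul_right_injective₀ two_ne_zero))
  rw [← tsum_even_add_odd hev hod]
  have h1 : ∑' j, b (2 * j) ≤ D + 3 * ε ^ 2 / 16 :=
    hasSum_le heven hev.hasSum (hexp.add (hasSum_ite_eq 1 _))
  have h2 : ∑' j, b (2 * j + 1) ≤ ε * D := hasSum_le hodd hod.hasSum (hexp.mul_left ε)
  have h3 : 1 + ε ^ 2 / 16 ≤ D := by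
    have := Real.add_one_le_exp (ε ^ 2 / 16)
    linarith
  nlinarith [mul_le_mul_of_nonneg_left h3 hε, mul_nonneg hε (sq_nonneg (ε - 4))]

theorem tsum_pow_div_factorial_sq_le_cL {ε : ℝ} (hε : 0 < ε) {n : ℕ} (hn : mL ε ≤ n) :
    ∑' k : ℕ, ε ^ k / (k.factorial : ℝ) ^ 2 ≤
      cL ε * (n : ℝ) ^ (-(1 / 4) : ℝ) * Real.exp (2 * √(ε * n)) := by
  refine (tsum_pow_div_factorial_sq_le_exp hε.le).trans ?_
  have h5 : 5 * ε ≤ n := ((le_max_left _ _).trans (le_max_left _ _)).trans hn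
  have h9 : 9 / ε ≤ n := (le_max_right _ _).trans hn
  have hn0 : (0 : ℝ) < n := by linarith
  set t := √(ε * n) with ht
  have hεn : 9 ≤ ε * n := by rwa [div_le_iff₀' hε] at h9
  have ht3 : 3 ≤ t := Real.le_sqrt_of_sq_le (by linarith)
  have htε : 2 * ε ≤ t := Real.le_sqrt_of_sq_le (by nlinarith)
  set E := ε ^ (1 / 4 : ℝ) with hE
  set N := (n : ℝ) ^ (1 / 4 : ℝ) with hN
  have hEpos : 0 < E := Real.rpow_pos_of_pos hε _
  have hNpos : 0 < N := Real.rpow_pos_of_pos hn0 _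
  have hEN : (E * N) ^ 2 = t := by
    rw [ht, hE, hN, ← Real.mul_rpow hε.le hn0.le, Real.sqrt_eq_rpow, ← Real.rpow_natCast,
      ← Real.rpow_mul (by positivity)]
    norm_num
  have hrpow : (n : ℝ) ^ (-(1 / 4) : ℝ) = N⁻¹ := Real.rpow_neg hn0.le _
  have hsum : 3 ≤ 3 + √(Real.pi / Real.exp 1) + 2 / (√Real.pi * E) + 7 / (16 * √ε)
      + √ε * (2 + ε) := by
    have : 0 ≤ √(Real.pi / Real.exp 1) + 2 / (√Real.pi * E) + 7 / (16 * √ε) + √ε * (2 + ε) := by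
      positivity
    linarith
  have hpi : √Real.pi ≤ 2 := Real.sqrt_le_iff.2 ⟨by norm_num, by linarith [Real.pi_le_four]⟩
  -- Of the bracket in `cL` only the summand 3 is kept, and `√π` is replaced by 2.
  have hcL : Real.exp (-(3 / 2) * ε + 2 * √ε) / (2 * 2 * E) * 3 ≤ cL ε := by
    unfold cL
    rw [← hE]
    gcongr
  have hcL0 : 0 ≤ cL ε := le_trans (by positivity) hcL
  rw [hrpow]
  -- Uses `2EN ≤ t + 1`, from `(EN)² = t`, together with `ε ≤ t/2`.
  have hexp : (4 / 3) * (E * N) ≤ Real.exp (2 * t - 3 / 2 * ε) := by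
    have := Real.add_one_le_exp (2 * t - 3 / 2 * ε)
    nlinarith [sq_nonneg (E * N - 1)]
  calc Real.exp (2 * √ε)
      = Real.exp (-(3 / 2) * ε + 2 * √ε) / (2 * 2 * E) * 3 * N⁻¹ *
          ((4 / 3) * (E * N) * Real.exp (3 / 2 * ε)) := by
        rw [Real.exp_add, neg_mul, Real.exp_neg]
        field_simp
        norm_num
    _ ≤ cL ε * N⁻¹ * (Real.exp (2 * t - 3 / 2 * ε) * Real.exp (3 / 2 * ε)) := by gcongr
    _ = cL ε * N⁻¹ * Real.exp (2 * t) := by rw [← Real.exp_add]; ring_nf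

/-! ### Worst-case errors through error representers -/

section Representer

variable {H : Type*} [NormedAddCommGroup H] [InnerProductSpace ℝ H] [CompleteSpace H]
  [RKHS ℝ H UnitSym ℝ]

variable (H) in
/-- The Riesz representer of the error functional `f ↦ f(x) - (A f)(x)`. -/
noncomputable def LinearApprox.errorRepresenter {n : ℕ} (A : LinearApprox n) (x : UnitSym) : H :=
  RKHS.kerFun H x (1 : ℝ) - ∑ i, A.weight i x • RKHS.kerFun H (A.point i) (1 : ℝ)

theorem LinearApprox.inner_errorRepresenter {n : ℕ} (A : LinearApprox n) (x : UnitSym) (f : H) :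
    inner ℝ (A.errorRepresenter H x) f = f x - A.apply f x := by
  simp only [errorRepresenter, inner_sub_left, sum_inner, inner_smul_left, RKHS.kerFun_inner,
    LinearApprox.apply]
  simp [mul_comm]

/-- The squared norm is the error functional applied to its own representer, so expanding the kernel
twice suffices; no orthonormal basis is needed. -/
theorem LinearApprox.hasSum_norm_errorRepresenter_sq {ε : ℝ}
    (hK : HasScalarKernel H (besselKernel ε)) {n : ℕ} (A : LinearApprox n) (x : UnitSym) :
    HasSum (fun k : ℕ => ε ^ k / (k.factorial : ℝ) ^ 2 *
      ((x : ℝ) ^ k - ∑ i, A.weight i x * (A.point i : ℝ) ^ k) ^ 2)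
      (‖A.errorRepresenter H x‖ ^ 2) := by
  have hker : ∀ y z : UnitSym, HasSum (fun k : ℕ => ε ^ k / (k.factorial : ℝ) ^ 2 *
      ((z : ℝ) ^ k * (y : ℝ) ^ k)) (RKHS.kerFun H y (1 : ℝ) z) := by
    intro y z
    rw [RKHS.kerFun_apply, hK, _root_.smul_apply, ContinuousLinearMap.id_apply,
      smul_eq_mul, mul_one, besselKernel_eq_tsum]
    refine (summable_bessel ε z y).hasSum.congr_fun fun k => ?_
    rw [mul_inv, inv_pow, inv_inv]
    ring
  have hrep : ∀ z : UnitSym, HasSum (fun k : ℕ => ε ^ k / (k.factorial : ℝ) ^ 2 *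
      ((z : ℝ) ^ k * ((x : ℝ) ^ k - ∑ i, A.weight i x * (A.point i : ℝ) ^ k)))
      (A.errorRepresenter H x z) := by
    intro z
    have e : A.errorRepresenter H x z = RKHS.kerFun H x (1 : ℝ) z -
        ∑ i, A.weight i x * RKHS.kerFun H (A.point i) (1 : ℝ) z := by
      have h : A.errorRepresenter H x z =
          inner ℝ (RKHS.kerFun H z (1 : ℝ)) (A.errorRepresenter H x) := by
        simp [RKHS.kerFun_inner]
      rw [h, errorRepresenter, inner_sub_right, inner_sum]
      simp only [inner_smul_right, RKHS.kerFun_inner]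
      simp
    rw [e]
    have := (hker x z).sub (hasSum_sum (s := Finset.univ) fun i _ =>
      (hker (A.point i) z).mul_left (A.weight i x))
    refine this.congr_fun fun k => ?_
    simp only [mul_sub, Finset.mul_sum]
    congr 1
    exact Finset.sum_congr rfl fun i _ => by ring
  rw [← real_inner_self_eq_norm_sq, A.inner_errorRepresenter, LinearApprox.apply]
  have := (hrep x).sub (hasSum_sum (s := Finset.univ) fun i _ =>
      (hrep (A.point i)).mul_right (A.weight i x))
  refine this.congr_fun fun k => ?_
  set g := (x : ℝ) ^ k - ∑ i, A.weight i x * (A.point i : ℝ) ^ k with hg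
  have e : ∑ i, ε ^ k / (k.factorial : ℝ) ^ 2 * ((A.point i : ℝ) ^ k * g) * A.weight i x =
      ε ^ k / (k.factorial : ℝ) ^ 2 * g * ∑ i, A.weight i x * (A.point i : ℝ) ^ k := by
    rw [Finset.mul_sum]
    exact Finset.sum_congr rfl fun i _ => by ring
  rw [e]
  have : ∑ i, A.weight i x * (A.point i : ℝ) ^ k = (x : ℝ) ^ k - g := by rw [hg]; ring
  rw [this]
  ring

theorem worstCaseError_le_of_norm_errorRepresenter_le {n : ℕ} (A : LinearApprox n) {M : ℝ}
    (h : ∀ x, ‖A.errorRepresenter H x‖ ≤ M) : worstCaseError H A ≤ ENNReal.ofReal M := by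
  refine iSup₂_le fun f _ => ENNReal.div_le_of_le_mul (iSup_le fun x => ?_)
  have hM : 0 ≤ M := (norm_nonneg _).trans (h x)
  rw [← ENNReal.ofReal_mul hM]
  beta_reduce
  rw [← A.inner_errorRepresenter x f]
  refine ENNReal.ofReal_le_ofReal ((abs_real_inner_le_norm _ _).trans ?_)
  gcongr
  exact h x

/-- The representer itself serves as test function. -/
theorem ofReal_norm_errorRepresenter_le_worstCaseError {n : ℕ} (A : LinearApprox n)
    (x : UnitSym) : ENNReal.ofReal ‖A.errorRepresenter H x‖ ≤ worstCaseError H A := by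
  rcases eq_or_ne (A.errorRepresenter H x) 0 with h0 | h0
  · simp [h0]
  have hpos := norm_pos_iff.2 h0
  refine le_iSup₂_of_le (A.errorRepresenter H x) h0 ?_
  rw [ENNReal.le_div_iff_mul_le (Or.inl (by simpa using h0)) (Or.inl ENNReal.ofReal_ne_top),
    ← ENNReal.ofReal_mul hpos.le]
  refine le_iSup_of_le x (ENNReal.ofReal_le_ofReal ?_)
  beta_reduce
  rw [← A.inner_errorRepresenter, real_inner_self_eq_norm_mul_norm]
  exact le_abs_self _

/-- The approximation by Lagrange interpolation. -/
noncomputable def lagrangeApprox {n : ℕ} (v : Fin n → UnitSym) (hv : Function.Injective v) :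
    LinearApprox n where
  point := v
  point_injective := hv
  weight i x := (Lagrange.basis Finset.univ (fun j => (v j : ℝ)) i).eval (x : ℝ)
  weight_measurable i := by
    have : Continuous fun x : UnitSym =>
      (Lagrange.basis Finset.univ (fun j => (v j : ℝ)) i).eval (x : ℝ) := by fun_prop
    exact this.measurable.nullMeasurable

/-- Terms with `k < n` vanish; after shifting by `n`, `choose (k+n) n / (k+n)! = 1/(n! k!)`. -/
theorem hasSum_mul_choose_sq {ε : ℝ} (hε : 0 < ε) (n : ℕ) :
    HasSum (fun k : ℕ => ε ^ k / (k.factorial : ℝ) ^ 2 * (k.choose n : ℝ) ^ 2)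
      (ε ^ n / (n.factorial : ℝ) ^ 2 * ∑' k : ℕ, ε ^ k / (k.factorial : ℝ) ^ 2) := by
  have h := (hasSum_nat_add_iff (f := fun k : ℕ => ε ^ k / (k.factorial : ℝ) ^ 2 *
    (k.choose n : ℝ) ^ 2) (g := ε ^ n / (n.factorial : ℝ) ^ 2 *
      ∑' k : ℕ, ε ^ k / (k.factorial : ℝ) ^ 2) n).1 ?_
  · rwa [Finset.sum_eq_zero, add_zero] at h
    intro k hk
    simp [Nat.choose_eq_zero_of_lt (Finset.mem_range.1 hk)]
  · refine ((summable_pow_div_factorial_sq ε).hasSum.mul_left _).congr_fun fun k => ?_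
    rw [Nat.cast_choose ℝ (Nat.le_add_left n k), Nat.add_sub_cancel, pow_add]
    field_simp

theorem worstCaseError_lagrangeApprox_le {ε : ℝ} (hε : 0 < ε)
    (hK : HasScalarKernel H (besselKernel ε)) {n : ℕ} (v : Fin n → UnitSym)
    (hv : Function.Injective v) {M : ℝ} (hM : 0 ≤ M)
    (hbound : ∀ x : UnitSym, |∏ i, ((x : ℝ) - v i)| ≤ M) :
    worstCaseError H (lagrangeApprox v hv) ≤ ENNReal.ofReal (M * (√ε ^ n / n.factorial *
      √(∑' k : ℕ, ε ^ k / (k.factorial : ℝ) ^ 2))) := by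
  set B := ∑' k : ℕ, ε ^ k / (k.factorial : ℝ) ^ 2 with hB
  have hB0 : 0 ≤ B := tsum_nonneg fun k => by positivity
  refine worstCaseError_le_of_norm_errorRepresenter_le _ fun x => ?_
  refine abs_le_of_sq_le_sq' ?_ (by positivity) |>.2
  have e : (M * (√ε ^ n / n.factorial * √B)) ^ 2 =
      (ε ^ n / (n.factorial : ℝ) ^ 2 * B) * M ^ 2 := by
    rw [mul_pow, mul_pow, Real.sq_sqrt hB0, div_pow, ← pow_mul, mul_comm n 2, pow_mul,
      Real.sq_sqrt hε.le]
    ring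
  rw [e]
  refine hasSum_le (fun k => ?_)
    ((lagrangeApprox v hv).hasSum_norm_errorRepresenter_sq hK x)
    ((hasSum_mul_choose_sq hε n).mul_right (M ^ 2))
  rw [mul_assoc, ← mul_pow]
  refine mul_le_mul_of_nonneg_left ?_ (by positivity)
  refine sq_le_sq' ?_ ?_ <;> [apply neg_le_of_abs_le; apply le_of_abs_le] <;>
  · refine (abs_pow_sub_sum_basis_le (fun j => (v j : ℝ)) (Subtype.val_injective.comp hv)
      (fun i => abs_le.2 (v i).2) k (abs_le.2 x.2)).trans ?_
    gcongr
    exact hbound x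

/-- Bounds the squared norm of the nodal polynomial: `k! · choose n k = n!/(n-k)!`, and reversing
the sum leaves a partial sum of `B`. -/
theorem sum_sq_coeff_nodal_le {ε : ℝ} (hε : 0 < ε) {n : ℕ} (v : Fin n → ℝ)
    (hv : ∀ i, |v i| ≤ 1) :
    ∑ k ∈ Finset.range (n + 1), ((k.factorial : ℝ) ^ 2 / ε ^ k) *
      (Lagrange.nodal Finset.univ v).coeff k ^ 2 ≤
      (n.factorial : ℝ) ^ 2 / ε ^ n * ∑' k : ℕ, ε ^ k / (k.factorial : ℝ) ^ 2 := by
  calc _ ≤ ∑ k ∈ Finset.range (n + 1), (n.factorial : ℝ) ^ 2 / ε ^ n *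
        (ε ^ (n - k) / ((n - k).factorial : ℝ) ^ 2) := by
        refine Finset.sum_le_sum fun k hk => ?_
        have hkn : k ≤ n := Nat.lt_succ_iff.1 (Finset.mem_range.1 hk)
        have h1 := abs_coeff_nodal_le_choose Finset.univ v (fun i _ => hv i) k
        rw [Finset.card_univ, Fintype.card_fin] at h1
        calc _ ≤ ((k.factorial : ℝ) ^ 2 / ε ^ k) * (n.choose k : ℝ) ^ 2 := by
              rw [← sq_abs (Polynomial.coeff _ _)]
              gcongr
          _ = _ := by
              rw [Nat.cast_choose ℝ hkn, ← Nat.sub_add_cancel hkn, pow_add, Nat.sub_add_cancel hkn]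
              field_simp
    _ = (n.factorial : ℝ) ^ 2 / ε ^ n *
        ∑ k ∈ Finset.range (n + 1), ε ^ k / (k.factorial : ℝ) ^ 2 := by
        rw [← Finset.mul_sum,
          ← Finset.sum_range_reflect (fun k => ε ^ k / (k.factorial : ℝ) ^ 2) (n + 1)]
        simp
    _ ≤ _ := by
        gcongr
        exact (summable_pow_div_factorial_sq ε).sum_le_tsum _ fun k _ => by positivity

theorem le_worstCaseError {ε : ℝ} (hε : 0 < ε) (hK : HasScalarKernel H (besselKernel ε)) {n : ℕ}
    (hn : n ≠ 0) (A : LinearApprox n) :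
    ENNReal.ofReal (2 * (1 / 2) ^ n * (√ε ^ n / n.factorial /
      √(∑' k : ℕ, ε ^ k / (k.factorial : ℝ) ^ 2))) ≤ worstCaseError H A := by
  set B := ∑' k : ℕ, ε ^ k / (k.factorial : ℝ) ^ 2 with hB
  have hB0 : 0 < B := (summable_pow_div_factorial_sq ε).tsum_pos (fun k => by positivity) 0
    (by simp)
  set v : Fin n → ℝ := fun i => A.point i with hv
  obtain ⟨x, hx, hmin⟩ := exists_two_mul_half_pow_le_abs_prod hn v
  lift x to UnitSym using hx
  refine le_trans (ENNReal.ofReal_le_ofReal ?_) (ofReal_norm_errorRepresenter_le_worstCaseError A x)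
  set P := Lagrange.nodal Finset.univ v with hP
  set g : ℕ → ℝ := fun k => (x : ℝ) ^ k - ∑ i, A.weight i x * (A.point i : ℝ) ^ k with hg
  have hdeg : P.natDegree < n + 1 := by rw [hP, Lagrange.natDegree_nodal]; simp
  -- The error functional applied to the nodal polynomial: the weights drop out since it vanishes at
  -- the nodes.
  have hval : ∑ k ∈ Finset.range (n + 1), P.coeff k * g k = ∏ i, ((x : ℝ) - v i) := by
    have h0 : ∀ i, P.eval (v i) = 0 := fun i => Lagrange.eval_nodal_at_node (Finset.mem_univ i)
    have h1 : P.eval (x : ℝ) - ∑ i, A.weight i x * P.eval (v i) =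
        ∏ i, ((x : ℝ) - v i) := by
      simp only [h0, mul_zero, Finset.sum_const_zero, sub_zero]
      exact Lagrange.eval_nodal
    rw [← h1]
    simp only [Polynomial.eval_eq_sum_range' hdeg, hg, mul_sub, Finset.sum_sub_distrib,
      Finset.mul_sum]
    rw [Finset.sum_comm]
    congr 1
    exact Finset.sum_congr rfl fun i _ => Finset.sum_congr rfl fun k _ => by ring
  have hcs : (∏ i, ((x : ℝ) - v i)) ^ 2 ≤
      ((n.factorial : ℝ) ^ 2 / ε ^ n * B) * ‖A.errorRepresenter H x‖ ^ 2 := by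
    rw [← hval]
    refine (Finset.sum_sq_le_sum_mul_sum_of_sq_le_mul (Finset.range (n + 1))
      (f := fun k => ((k.factorial : ℝ) ^ 2 / ε ^ k) * P.coeff k ^ 2)
      (g := fun k => ε ^ k / (k.factorial : ℝ) ^ 2 * g k ^ 2)
      (fun k _ => by positivity) (fun k _ => by positivity) fun k _ => ?_).trans ?_
    · refine le_of_eq ?_
      field_simp
    · gcongr
      · exact sum_sq_coeff_nodal_le hε v fun i => abs_le.2 (A.point i).2
      · exact sum_le_hasSum _ (fun k _ => by positivity)
          (A.hasSum_norm_errorRepresenter_sq hK x)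
  have e : ((n.factorial : ℝ) ^ 2 / ε ^ n * B) * ‖A.errorRepresenter H x‖ ^ 2 =
      (n.factorial / √ε ^ n * √B * ‖A.errorRepresenter H x‖) ^ 2 := by
    rw [mul_pow, mul_pow, Real.sq_sqrt hB0.le, div_pow, ← pow_mul, mul_comm n 2, pow_mul,
      Real.sq_sqrt hε.le]
  rw [e] at hcs
  have h2 := hmin.trans (abs_le_of_sq_le_sq hcs (by positivity))
  have hs : 0 < √ε ^ n := by positivity
  have hB' : 0 < √B := Real.sqrt_pos.2 hB0
  calc _ ≤ (n.factorial / √ε ^ n * √B * ‖A.errorRepresenter H x‖) *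
        (√ε ^ n / n.factorial / √B) := by gcongr
    _ = _ := by field_simp

end Representer

/-! ### Assembly of the bounds -/

theorem mainTheorem9 (ε : ℝ) (hε : 0 < ε)
    (H : Type*) [NormedAddCommGroup H] [InnerProductSpace ℝ H] [CompleteSpace H]
    [RKHS ℝ H UnitSym ℝ] (hK : HasScalarKernel H (besselKernel ε))
    (c₁ c₂ : ℝ) (hc₁ : c₁ = √(2 / (1 + ε)) * Real.exp (-(1 / 32) * ε ^ 2))
    (hc₂ : c₂ = 2 * √(cL ε))
    (n : ℕ) (hn : mL ε ≤ n) :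
    (ENNReal.ofReal (c₁ * (√ε / 2) ^ n * (n.factorial : ℝ)⁻¹) ≤ minimalError H n ∧
      minimalError H n ≤
        ENNReal.ofReal (c₂ * (n : ℝ) ^ (-(1 / 8) : ℝ) * Real.exp √(ε * n) * (√ε / 2) ^ n *
          (n.factorial : ℝ)⁻¹)) ∧
    ∀ x : Fin n → UnitSym, Function.Injective x →
      ∃ A : LinearApprox n, A.point = x ∧
        ENNReal.ofReal (c₁ * (√ε / 2) ^ n * (n.factorial : ℝ)⁻¹) ≤ worstCaseError H A ∧
        worstCaseError H A ≤
          ENNReal.ofReal (c₂ / 2 * (n : ℝ) ^ (-(1 / 8) : ℝ) * Real.exp √(ε * n) *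
            (2 * √ε) ^ n * (n.factorial : ℝ)⁻¹) := by
  have hnpos : (0 : ℝ) < n := by
    have : 5 * ε ≤ n := ((le_max_left _ _).trans (le_max_left _ _)).trans hn
    linarith
  have hn0 : n ≠ 0 := by rintro rfl; simp at hnpos
  set B := ∑' k : ℕ, ε ^ k / (k.factorial : ℝ) ^ 2 with hB
  have hB0 : 0 < B := (summable_pow_div_factorial_sq ε).tsum_pos (fun k => by positivity) 0
    (by simp)
  -- `c₁` is exactly 2 divided by the square root of `2(1+ε) exp (ε²/16)`.
  have hlow : c₁ ≤ 2 / √B := by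
    rw [le_div_iff₀ (Real.sqrt_pos.2 hB0), hc₁]
    have h1 : √B ≤ √(2 * (1 + ε)) * Real.exp (1 / 32 * ε ^ 2) := by
      rw [Real.sqrt_le_left (by positivity), mul_pow, Real.sq_sqrt (by positivity),
        ← Real.exp_nat_mul]
      refine (tsum_pow_div_factorial_sq_le_mul_exp hε.le).trans (le_of_eq ?_)
      congr 2
      push_cast
      ring
    calc _ ≤ √(2 / (1 + ε)) * Real.exp (-(1 / 32) * ε ^ 2) *
          (√(2 * (1 + ε)) * Real.exp (1 / 32 * ε ^ 2)) := by gcongr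
      _ = (√(2 / (1 + ε)) * √(2 * (1 + ε))) *
          (Real.exp (-(1 / 32) * ε ^ 2) * Real.exp (1 / 32 * ε ^ 2)) := by ring
      _ = 2 := by
          rw [← Real.exp_add, ← Real.sqrt_mul (by positivity),
            show 2 / (1 + ε) * (2 * (1 + ε)) = 2 ^ 2 by field_simp,
            Real.sqrt_sq (by norm_num)]
          simp
  have hup : √B ≤ √(cL ε) * (n : ℝ) ^ (-(1 / 8) : ℝ) * Real.exp √(ε * n) := by
    have hcL : 0 ≤ cL ε := by unfold cL; positivity
    rw [Real.sqrt_le_left (by positivity), mul_pow, mul_pow, Real.sq_sqrt hcL,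
      ← Real.exp_nat_mul, ← Real.rpow_mul_natCast hnpos.le]
    have := tsum_pow_div_factorial_sq_le_cL hε hn
    norm_num at this ⊢
    exact this
  have hlower : ∀ A : LinearApprox n,
      ENNReal.ofReal (c₁ * (√ε / 2) ^ n * (n.factorial : ℝ)⁻¹) ≤ worstCaseError H A := by
    intro A
    refine le_trans (ENNReal.ofReal_le_ofReal ?_) (le_worstCaseError hε hK hn0 A)
    calc _ ≤ 2 / √B * (√ε / 2) ^ n * (n.factorial : ℝ)⁻¹ := by gcongr
      _ = _ := by rw [← hB, div_pow, div_pow, one_pow]; ring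
  refine ⟨⟨le_iInf hlower, ?_⟩, fun x hx => ⟨lagrangeApprox x hx, rfl, hlower _, ?_⟩⟩
  · obtain ⟨v, hv, hbound⟩ := exists_chebyshev_nodes hn0
    refine (iInf_le _ (lagrangeApprox v hv)).trans
      ((worstCaseError_lagrangeApprox_le hε hK v hv (by positivity) hbound).trans
        (ENNReal.ofReal_le_ofReal ?_))
    calc _ ≤ 2 * (1 / 2) ^ n * (√ε ^ n / n.factorial *
          (√(cL ε) * (n : ℝ) ^ (-(1 / 8) : ℝ) * Real.exp √(ε * n))) := by gcongr
      _ = _ := by rw [hc₂, div_pow, div_pow, one_pow]; ring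
  · have hbound : ∀ y : UnitSym, |∏ i, ((y : ℝ) - x i)| ≤ 2 ^ n := by
      intro y
      rw [Finset.abs_prod]
      refine (Finset.prod_le_prod (fun i _ => abs_nonneg _) (g := fun _ => (2 : ℝ))
        fun i _ => ?_).trans (by simp)
      have h1 := y.2
      have h2 := (x i).2
      exact abs_le.2 ⟨by linarith [h1.1, h2.2], by linarith [h1.2, h2.1]⟩
    refine (worstCaseError_lagrangeApprox_le hε hK x hx (by positivity) hbound).trans
        (ENNReal.ofReal_le_ofReal ?_)
    calc _ ≤ 2 ^ n * (√ε ^ n / n.factorial *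
          (√(cL ε) * (n : ℝ) ^ (-(1 / 8) : ℝ) * Real.exp √(ε * n))) := by gcongr
      _ = _ := by rw [hc₂, mul_pow]; ring
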